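/- For density matrices $\rho,\sigma$ let $\mathrm{F}(\rho,\sigma)=\operatorname{tr}\sqrt{\sqrt{\sigma}\,\rho\,\sqrt{\sigma}}$ be the (square root) fidelity, and write $\mathrm{F}(\rho,|\psi\rangle)=\mathrm{F}(\rho,|\psi\rangle\langle\psi|)$ for a pure state $|\psi\rangle$. A quantum query algorithm with oracles $U,V$ starts a finite work register of qubits in the all-zero state, applies a fixed finite sequence of gates, measures all qubits in the computational basis, and outputs a real number that is a fixed function of the measurement outcome. Each gate is either a unitary that does not depend on the oracles or one query, that is, an application of $U$, $U^{-1}$, $V$, $V^{-1}$ or the controlled version of one of these to specified distinct qubits. **Theorem.** There is an absolute constant $C>0$ such that for all integers $k,a,b\ge 0$ and every $\varepsilon\in(0,1)$ there is a quantum query algorithm (depending only on $k,a,b,\varepsilon$) that makes at most $C/\varepsilon$ queries in total to (controlled-)$U$, (controlled-)$V$ and their inverses and has the following property. Let $\rho$ be a $k$-qubit mixed state and $|\psi\rangle$ a $k$-qubit pure state. Let $U$ be a unitary on a $k$-qubit register $\mathsf{A}$ and an $a$-qubit register $\mathsf{B}$, and $V$ a unitary on a $k$-qubit register $\mathsf{A}'$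 and a $b$-qubit register $\mathsf{B}'$, such that $$\rho=\operatorname{tr}_{\mathsf{B}}\big(|\rho\rangle\langle\rho|_{\mathsf{AB}}\big)\ \text{ with }\ |\rho\rangle_{\mathsf{AB}}=U|0\rangle_{\mathsf{A}}|0\rangle_{\mathsf{B}},\qquad V|0\rangle_{\mathsf{A}'}|0\rangle_{\mathsf{B}'}=|\psi\rangle_{\mathsf{A}'}|\psi'\rangle_{\mathsf{B}'}$$ for some pure state $|\psi'\rangle$ of $\mathsf{B}'$. Then $\mathrm{F}(\rho,|\psi\rangle)=\sqrt{\langle\psi|\rho|\psi\rangle}$, and with probability at least $2/3$ the output $\tilde x$ of the algorithm on the oracles $U,V$ satisfies $|\tilde x-\mathrm{F}(\rho,|\psi\rangle)|<\varepsilon$. -/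

import Mathlib

open scoped ComplexOrder Matrix MatrixOrder Matrix.Norms.L2Operator

noncomputable section

/-! ### Qubit registers and states -/

/-- Computational basis labels of a register whose qubits are labelled by `Q`. Vectors
`Bits Q → ℂ` are the state vectors of the register, in the computational basis. -/
abbrev Bits (Q : Type) : Type := Q → Bool

/-- The unitary operators on the register `Q`, as matrices in the computational basis. -/
abbrev QUnitary (Q : Type) [Fintype Q] [DecidableEq Q] : Type :=
  Matrix.unitaryGroup (Bits Q) ℂ

/-- The all-zero basis state `|0⟩` of the register `Q`. -/
def zeroKet (Q : Type) [Fintype Q] [DecidableEq Q] : Bits Q → ℂ :=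
  Pi.single (fun _ => false) 1

/-- `φ` is a (normalized) pure state. -/
def IsPureState {Q : Type} [Fintype Q] [DecidableEq Q] (φ : Bits Q → ℂ) : Prop :=
  ∑ x, ‖φ x‖ ^ 2 = 1

/-- `ρ` is a mixed state, that is, a density matrix. -/
def IsMixedState {Q : Type} [Fintype Q] [DecidableEq Q]
    (ρ : Matrix (Bits Q) (Bits Q) ℂ) : Prop :=
  ρ.PosSemidef ∧ ρ.trace = 1

/-- The operator `|φ⟩⟨φ|`. -/
def ketBra {Q : Type} (φ : Bits Q → ℂ) : Matrix (Bits Q) (Bits Q) ℂ :=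
  Matrix.vecMulVec φ (star φ)

/-- The product vector `|φ⟩_A |χ⟩_B` on the joint register `A ⊕ B`. -/
def tensorKet {A B : Type} (φ : Bits A → ℂ) (χ : Bits B → ℂ) : Bits (A ⊕ B) → ℂ :=
  fun z => φ (z ∘ Sum.inl) * χ (z ∘ Sum.inr)

/-- The partial trace `tr_B` over the second part of the joint register `A ⊕ B`. -/
def partialTraceB {A B : Type} [Fintype B] [DecidableEq B]
    (M : Matrix (Bits (A ⊕ B)) (Bits (A ⊕ B)) ℂ) : Matrix (Bits A) (Bits A) ℂ :=
  Matrix.of fun x y => ∑ b : Bits B, M (Sum.elim x b) (Sum.elim y b)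

/-- The (square root) fidelity `F(ρ, σ) = tr √(√σ ρ √σ)`; the trace is a nonnegative real
number when `ρ` and `σ` are states. -/
def fidelity {Q : Type} [Fintype Q] [DecidableEq Q]
    (ρ σ : Matrix (Bits Q) (Bits Q) ℂ) : ℝ :=
  (CFC.sqrt (CFC.sqrt σ * ρ * CFC.sqrt σ)).trace.re

/-! ### State preparation -/

/-- `U` prepares a purification of `ρ`: tracing out `B` from `U |0⟩_A |0⟩_B` leaves `ρ`. -/
def PreparesMixed {A B : Type} [Fintype A] [DecidableEq A] [Fintype B] [DecidableEq B]
    (U : QUnitary (A ⊕ B)) (ρ : Matrix (Bits A) (Bits A) ℂ) : Prop :=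
  ρ = partialTraceB (ketBra (U.val *ᵥ zeroKet (A ⊕ B)))

/-- `V` prepares `ψ` together with some pure state on the redundant output register:
`V |0⟩_A |0⟩_B = |ψ⟩_A |ψ'⟩_B`. -/
def PreparesPure {A B : Type} [Fintype A] [DecidableEq A] [Fintype B] [DecidableEq B]
    (V : QUnitary (A ⊕ B)) (ψ : Bits A → ℂ) : Prop :=
  ∃ ψ' : Bits B → ℂ, IsPureState ψ' ∧ V.val *ᵥ zeroKet (A ⊕ B) = tensorKet ψ ψ'

/-! ### Quantum query algorithms -/

/-- The operator on the register `Q` that applies `M` to the qubits `e r` (`r : R`) and the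
identity to all other qubits. -/
def applyOn {R Q : Type} [Fintype Q] [DecidableEq Q] (e : R ↪ Q)
    (M : Matrix (Bits R) (Bits R) ℂ) : Matrix (Bits Q) (Bits Q) ℂ :=
  open Classical in
  Matrix.of fun x y =>
    if ∀ q, q ∉ Set.range e → x q = y q then M (x ∘ e) (y ∘ e) else 0

/-- Controlled-`M`, where `none` is the control qubit: `|0⟩⟨0| ⊗ I + |1⟩⟨1| ⊗ M`. -/
def controlled {R : Type} [Fintype R] [DecidableEq R] (M : Matrix (Bits R) (Bits R) ℂ) :
    Matrix (Bits (Option R)) (Bits (Option R)) ℂ :=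
  Matrix.of fun x y =>
    if x none = y none then
      if x none = true then M (x ∘ some) (y ∘ some)
      else (1 : Matrix (Bits R) (Bits R) ℂ) (x ∘ some) (y ∘ some)
    else 0

/-- The gate set of a query algorithm on the work register `Q` with access to an oracle `U` on a
register `R` and an oracle `V` on a register `S`: arbitrary oracle-independent unitaries, and
queries to `U`, `V`, their inverses (`inv = true`), and the controlled versions of these, on
any choice of distinct qubits. -/
inductive QGate (R S Q : Type) [Fintype Q] [DecidableEq Q] : Type
  | free (G : QUnitary Q)
  | queryU (inv : Bool) (e : R ↪ Q)
  | ctrlQueryU (inv : Bool) (e : Option R ↪ Q)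
  | queryV (inv : Bool) (e : S ↪ Q)
  | ctrlQueryV (inv : Bool) (e : Option S ↪ Q)

section Algorithm

variable {R S : Type} [Fintype R] [DecidableEq R] [Fintype S] [DecidableEq S]

/-- `U` itself, or its inverse if `inv = true`. -/
def oracleMatrix {R : Type} [Fintype R] [DecidableEq R] (inv : Bool) (U : QUnitary R) :
    Matrix (Bits R) (Bits R) ℂ :=
  if inv = true then (U⁻¹).val else U.val

/-- The operator that a gate performs when the oracles are `U` and `V`. -/
def QGate.toMatrix {Q : Type} [Fintype Q] [DecidableEq Q] (U : QUnitary R) (V : QUnitary S) :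
    QGate R S Q → Matrix (Bits Q) (Bits Q) ℂ
  | .free G => G.val
  | .queryU inv e => applyOn e (oracleMatrix inv U)
  | .ctrlQueryU inv e => applyOn e (controlled (oracleMatrix inv U))
  | .queryV inv e => applyOn e (oracleMatrix inv V)
  | .ctrlQueryV inv e => applyOn e (controlled (oracleMatrix inv V))

/-- The number of queries that a gate makes: one for each oracle gate, zero otherwise. -/
def QGate.queries {R S Q : Type} [Fintype Q] [DecidableEq Q] : QGate R S Q → ℕ
  | .free _ => 0
  | .queryU _ _ => 1
  | .ctrlQueryU _ _ => 1
  | .queryV _ _ => 1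
  | .ctrlQueryV _ _ => 1

/-- A quantum query algorithm with oracles on the registers `R` and `S` and a real output: a finite
work register, initially in the all-zero state; a list of gates, applied from left to
right; and a classical map from the outcome of the final computational basis measurement to the
output. None of these data depend on the oracles. -/
structure QueryAlgorithm (R S : Type) where
  Qubit : Type
  fintypeQubit : Fintype Qubit
  decEqQubit : DecidableEq Qubit
  gates : List (QGate R S Qubit)
  output : Bits Qubit → ℝ

attribute [instance] QueryAlgorithm.fintypeQubit QueryAlgorithm.decEqQubit

namespace QueryAlgorithm

/-- The total number of queries to the (controlled) oracles and their inverses. -/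
def queries {R S : Type} (𝒜 : QueryAlgorithm R S) : ℕ :=
  (𝒜.gates.map QGate.queries).sum

/-- The state before the measurement, when the oracles are `U` and `V`. -/
def finalState (𝒜 : QueryAlgorithm R S) (U : QUnitary R) (V : QUnitary S) :
    Bits 𝒜.Qubit → ℂ :=
  𝒜.gates.foldl (fun v g => g.toMatrix U V *ᵥ v) (zeroKet 𝒜.Qubit)

/-- The probability that the output lies in `E`, when the oracles are `U` and `V` (Born rule). -/
def outputProb (𝒜 : QueryAlgorithm R S) (U : QUnitary R) (V : QUnitary S) (E : Set ℝ) : ℝ :=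
  ∑ z : Bits 𝒜.Qubit, (𝒜.output ⁻¹' E).indicator (fun z => ‖𝒜.finalState U V z‖ ^ 2) z

end QueryAlgorithm

end Algorithm

end

/-! The algorithm is amplitude estimation. Prepare `U|0⟩` on AB and `V|0⟩ = |ψ⟩|ψ'⟩` on A'B', then
apply `V⁻¹` across A and B' (`overlapPreparation`, call it W). Being zero on AB' then means that A
was projected onto `ψ` and B' onto `ψ'`, so it has probability `⟨ψ|ρ|ψ⟩ = F²`
(`sum_norm_sq_overlapPreparation`). Estimating the amplitude F itself rather than its square gives
the `1/ε` cost.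

Let `s = W|0⟩` and let G be the Grover iterate. Then `G²s + s = (2 - 4F²) G s`
(`groverIterate_quadratic`), and this relation replaces the eigendecomposition of G. Let `v m` be
the unnormalized state of phase estimation at outcome m and `ω = exp(2πi/N)`. As a combination of
the vectors `Gᵗ s`, it obeys the same relation, which forces `‖G v - v‖ = 2F‖v‖`
(`norm_map_sub_self_of_quadratic`). On the other hand `v m` is nearly an eigenvector for `ω^m`: by
Parseval the total squared defect `∑ ‖G (v m) - ω^m v m‖²` is the energy of the increments of the
window, `10/(N²+1)` for a parabola (`sum_norm_map_sub_smul_sq`). By the reverse triangle inequality,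
outcomes where `|ω^m - 1|/2` is at least ε away from F carry weight at most `10/(4ε²(N²+1))`, which
is below 1/3 once `Nε ≥ 3`. -/

noncomputable section

/-! ### The window of the phase register -/

/-- The parabolic window `t ↦ t (N - t)`, normalized on `{0, …, N - 1}`. -/
def parabolicWindow (N t : ℕ) : ℝ :=
  (t : ℝ) * (N - t) / √(N * ((N : ℝ) ^ 4 - 1) / 30)

@[simp] theorem parabolicWindow_zero (N : ℕ) : parabolicWindow N 0 = 0 := by
  simp [parabolicWindow]

@[simp] theorem parabolicWindow_self (N : ℕ) : parabolicWindow N N = 0 := by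
  simp [parabolicWindow]

/-- The parameter `x` is kept apart from the summation bound so that induction on `n` goes through;
it is later set to `N = n`. -/
theorem sum_range_sq_mul_sub (x : ℝ) (n : ℕ) :
    ∑ t ∈ Finset.range n, ((t : ℝ) * (x - t)) ^ 2 =
      x ^ 2 * ((n - 1) * n * (2 * n - 1) / 6) - 2 * x * (n * (n - 1) / 2) ^ 2 +
        (n - 1) * n * (2 * n - 1) * (3 * n ^ 2 - 3 * n - 1) / 30 := by
  induction n with
  | zero => simp
  | succ n ih => rw [Finset.sum_range_succ, ih]; push_cast; ring

theorem sum_range_sq_sub_two_mul (x : ℝ) (n : ℕ) :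
    ∑ t ∈ Finset.range n, (x - 1 - 2 * (t : ℝ)) ^ 2 =
      n * (x - 1) ^ 2 - 2 * (x - 1) * (n * (n - 1)) + 4 * ((n - 1) * n * (2 * n - 1) / 6) := by
  induction n with
  | zero => simp
  | succ n ih => rw [Finset.sum_range_succ, ih]; push_cast; ring

theorem mul_pow_four_sub_one_pos {N : ℕ} (hN : 2 ≤ N) : 0 < (N : ℝ) * ((N : ℝ) ^ 4 - 1) / 30 := by
  have h : (2 : ℝ) ≤ N := by exact_mod_cast hN
  have : (1 : ℝ) < (N : ℝ) ^ 4 := one_lt_pow₀ (by linarith) (by norm_num)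
  have : 0 < (N : ℝ) ^ 4 - 1 := by linarith
  positivity

theorem sum_parabolicWindow_sq {N : ℕ} (hN : 2 ≤ N) :
    ∑ t ∈ Finset.range N, parabolicWindow N t ^ 2 = 1 := by
  have h := mul_pow_four_sub_one_pos hN
  simp only [parabolicWindow, div_pow, Real.sq_sqrt h.le]
  rw [← Finset.sum_div, sum_range_sq_mul_sub, div_eq_one_iff_eq h.ne']
  ring

/-- This is the gain over a flat window, whose jump at the cyclic wrap-around would cost order
`1/N`. The parabola vanishes at both ends, so only its increments, proportional to `N - 1 - 2t`,
contribute. -/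
theorem sum_parabolicWindow_sub_sq {N : ℕ} (hN : 2 ≤ N) :
    ∑ t ∈ Finset.range N, (parabolicWindow N (t + 1) - parabolicWindow N t) ^ 2 =
      10 / ((N : ℝ) ^ 2 + 1) := by
  have h := mul_pow_four_sub_one_pos hN
  have key (t : ℕ) : (parabolicWindow N (t + 1) - parabolicWindow N t) ^ 2 =
      ((N : ℝ) - 1 - 2 * t) ^ 2 / (N * ((N : ℝ) ^ 4 - 1) / 30) := by
    rw [parabolicWindow, parabolicWindow, ← sub_div, div_pow, Real.sq_sqrt h.le]
    push_cast; ring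
  simp only [key]
  rw [← Finset.sum_div, sum_range_sq_sub_two_mul, div_eq_div_iff h.ne' (by positivity)]
  ring

/-! ### The Fourier basis -/

/-- The matrix of the inverse discrete Fourier transform on `ZMod N`, as a unitary matrix. -/
def fourierMatrix (N : ℕ) [NeZero N] : Matrix (ZMod N) (ZMod N) ℂ :=
  Matrix.of fun m j => ((√(N : ℝ) : ℝ) : ℂ)⁻¹ * ZMod.stdAddChar (-(m * j))

theorem star_stdAddChar {N : ℕ} [NeZero N] (x : ZMod N) :
    star (ZMod.stdAddChar x : ℂ) = ZMod.stdAddChar (-x) := by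
  rw [AddChar.map_neg_eq_conj]; rfl

theorem fourierMatrix_mem_unitaryGroup (N : ℕ) [NeZero N] :
    fourierMatrix N ∈ Matrix.unitaryGroup (ZMod N) ℂ := by
  rw [Matrix.mem_unitaryGroup_iff]
  ext m m'
  have hN : (N : ℂ) ≠ 0 := Nat.cast_ne_zero.2 (NeZero.ne N)
  have hs : (((√(N : ℝ) : ℝ) : ℂ)⁻¹ * ((√(N : ℝ) : ℝ) : ℂ)⁻¹) = (N : ℂ)⁻¹ := by
    rw [← mul_inv, ← Complex.ofReal_mul, Real.mul_self_sqrt (Nat.cast_nonneg N),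
      Complex.ofReal_natCast]
  have key (j : ZMod N) : fourierMatrix N m j * star (fourierMatrix N m' j) =
      (N : ℂ)⁻¹ * ZMod.stdAddChar (j * (m' - m)) := by
    simp only [fourierMatrix, Matrix.of_apply, star_mul, star_stdAddChar, neg_neg, star_inv₀]
    rw [show j * (m' - m) = -(m * j) + m' * j by ring, AddChar.map_add_eq_mul, ← hs]
    simp only [Complex.star_def, Complex.conj_ofReal]
    ring
  simp only [Matrix.mul_apply, Matrix.star_apply, key, ← Finset.mul_sum,
    AddChar.sum_mulShift _ (ZMod.isPrimitive_stdAddChar N), sub_eq_zero, Matrix.one_apply]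
  by_cases h : m = m'
  · simp [h, ZMod.card, hN]
  · simp [h, Ne.symm h]

/-- Parseval for families of vectors: expand the inner products and use orthonormality of the
columns of `A`. -/
theorem sum_norm_sq_unitary {ι H : Type*} [Fintype ι] [DecidableEq ι] [NormedAddCommGroup H]
    [InnerProductSpace ℂ H] {A : Matrix ι ι ℂ} (hA : A ∈ Matrix.unitaryGroup ι ℂ) (y : ι → H) :
    ∑ m, ‖∑ j, A m j • y j‖ ^ 2 = ∑ j, ‖y j‖ ^ 2 := by
  have hA' := Matrix.mem_unitaryGroup_iff'.1 hA
  have hd (j l : ι) : ∑ m, (starRingEnd ℂ) (A m l) * A m j = if l = j then 1 else 0 := by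
    have := congrFun (congrFun hA' l) j
    simpa [Matrix.mul_apply, Matrix.one_apply] using this
  have hn (z : H) : ((‖z‖ : ℝ) : ℂ) ^ 2 = inner ℂ z z := (inner_self_eq_norm_sq_to_K (𝕜 := ℂ) z).symm
  apply Complex.ofReal_injective
  push_cast
  simp only [hn, sum_inner, inner_sum, inner_smul_left, inner_smul_right, Finset.mul_sum]
  calc _ = ∑ j, ∑ l, (∑ m, (starRingEnd ℂ) (A m l) * A m j) * inner ℂ (y l) (y j) := by
        rw [Finset.sum_comm]
        refine Finset.sum_congr rfl fun j _ => ?_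
        rw [Finset.sum_comm]
        refine Finset.sum_congr rfl fun l _ => ?_
        rw [Finset.sum_mul]
        refine Finset.sum_congr rfl fun m _ => ?_
        ring
    _ = _ := by simp [hd]

/-! ### Phase estimation without an eigendecomposition -/

section PhaseEstimation

variable {H : Type*} [NormedAddCommGroup H] [InnerProductSpace ℂ H]

/-- Pairing the relation with `G u` and using that `G` is an isometry gives `2 Re⟨Gu, u⟩ = (2 -
4F²)‖u‖²`; expand `‖Gu - u‖²`. -/
theorem norm_map_sub_self_of_quadratic (G : H →ₗᵢ[ℂ] H) {u : H} {F : ℝ} (hF : 0 ≤ F)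
    (hu : G (G u) + u = ((2 - 4 * F ^ 2 : ℝ) : ℂ) • G u) : ‖G u - u‖ = 2 * F * ‖u‖ := by
  have h1 : inner ℂ (G u) (G (G u) + u) = ((2 - 4 * F ^ 2 : ℝ) : ℂ) * ((‖u‖ ^ 2 : ℝ) : ℂ) := by
    rw [hu, inner_smul_right, inner_self_eq_norm_sq_to_K, G.norm_map]
    simp
  rw [inner_add_right, G.inner_map_map] at h1
  have h2 : 2 * (inner ℂ (G u) u).re = (2 - 4 * F ^ 2) * ‖u‖ ^ 2 := by
    have h3 := congrArg Complex.re h1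
    rw [← Complex.ofReal_mul, Complex.ofReal_re, Complex.add_re, ← inner_conj_symm u (G u),
      Complex.conj_re] at h3
    linarith
  have h4 : ‖G u - u‖ ^ 2 = (2 * F * ‖u‖) ^ 2 := by
    rw [@norm_sub_sq ℂ, G.norm_map]
    simp only [RCLike.re_to_complex]
    linarith
  exact (sq_eq_sq₀ (norm_nonneg _) (by positivity)).1 h4

variable (N : ℕ) [NeZero N] (G : H →ₗᵢ[ℂ] H) (s : H)

/-- The unnormalized state left by phase estimation of `G` on `s` when the outcome is `m`. -/
def phaseEstimationVector (m : ZMod N) : H :=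
  ∑ j : ZMod N, fourierMatrix N m j • ((parabolicWindow N j.val : ℂ) • G^[j.val] s)

variable {N G s}

theorem norm_iterate_map (t : ℕ) (u : H) : ‖G^[t] u‖ = ‖u‖ := by
  induction t with
  | zero => rfl
  | succ t ih => rw [Function.iterate_succ_apply', G.norm_map, ih]

theorem sum_zmod_val {M : Type*} [AddCommMonoid M] (f : ℕ → M) :
    ∑ j : ZMod N, f j.val = ∑ t ∈ Finset.range N, f t := by
  refine Finset.sum_bij' (fun j _ => j.val) (fun t _ => (t : ZMod N)) ?_ ?_ ?_ ?_ ?_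
  · intro j _; exact Finset.mem_range.2 (ZMod.val_lt j)
  · simp
  · simp
  · intro t ht; exact ZMod.val_cast_of_lt (Finset.mem_range.1 ht)
  · simp

theorem sum_norm_phaseEstimationVector_sq (hN : 2 ≤ N) (hs : ‖s‖ = 1) :
    ∑ m, ‖phaseEstimationVector N G s m‖ ^ 2 = 1 := by
  simp only [phaseEstimationVector]
  rw [sum_norm_sq_unitary (fourierMatrix_mem_unitaryGroup N)]
  simp only [norm_smul, norm_iterate_map, hs, mul_one, Complex.norm_real, Real.norm_eq_abs, sq_abs]
  rw [sum_zmod_val fun t => parabolicWindow N t ^ 2, sum_parabolicWindow_sq hN]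

theorem quadratic_iterate {c : ℂ} (h : G (G s) + s = c • G s) (t : ℕ) :
    G (G (G^[t] s)) + G^[t] s = c • G (G^[t] s) := by
  induction t with
  | zero => exact h
  | succ t ih =>
    rw [Function.iterate_succ_apply', ← map_add, ih, map_smul]

/-- The relation is linear and passes from `s` to each `Gᵗ s`, hence to their combinations. -/
theorem quadratic_phaseEstimationVector {c : ℂ} (h : G (G s) + s = c • G s) (m : ZMod N) :
    G (G (phaseEstimationVector N G s m)) + phaseEstimationVector N G s m =
      c • G (phaseEstimationVector N G s m) := by
  simp only [phaseEstimationVector, map_sum, map_smul, Finset.smul_sum]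
  rw [← Finset.sum_add_distrib]
  refine Finset.sum_congr rfl fun j _ => ?_
  rw [← smul_add, ← smul_add, quadratic_iterate h, smul_comm c, smul_comm c]

theorem fourierMatrix_apply_eq_mul (m j : ZMod N) :
    fourierMatrix N m j = ZMod.stdAddChar m * fourierMatrix N m (j + 1) := by
  simp only [fourierMatrix, Matrix.of_apply]
  rw [show -(m * j) = m + -(m * (j + 1)) by ring, AddChar.map_add_eq_mul]
  ring

/-- Summation by parts: multiplying by `ω^m` shifts the Fourier index by one, so the defect is the
transform of `(w t - w (t+1)) Gᵗ⁺¹ s`, with w the window, and Parseval applies. -/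
theorem sum_norm_map_sub_smul_sq (hN : 2 ≤ N) (hs : ‖s‖ = 1) :
    ∑ m, ‖G (phaseEstimationVector N G s m) -
      (ZMod.stdAddChar m : ℂ) • phaseEstimationVector N G s m‖ ^ 2 = 10 / ((N : ℝ) ^ 2 + 1) := by
  let y (i : ZMod N) : H := (parabolicWindow N i.val : ℂ) • G^[i.val + 1] s -
    (parabolicWindow N (i + 1).val : ℂ) • G^[(i + 1).val] s
  have hy (i : ZMod N) :
      ‖y i‖ ^ 2 = (parabolicWindow N (i.val + 1) - parabolicWindow N i.val) ^ 2 := by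
    have hlt := ZMod.val_lt i
    have hadd : (i + 1).val = (i.val + 1) % N := by
      rw [ZMod.val_add, ZMod.val_one'' (by omega)]
    rcases (show i.val + 1 < N ∨ i.val + 1 = N by omega) with h | h
    · simp only [y]
      rw [hadd, Nat.mod_eq_of_lt h, ← sub_smul, norm_smul, norm_iterate_map, hs, mul_one,
        ← Complex.ofReal_sub, Complex.norm_real, Real.norm_eq_abs, sq_abs]
      ring
    -- Wrap-around: `i + 1` is `0` in `ZMod N`, and the window vanishes both at `0` and at `N`, so
    -- both sides are the same increment.
    · simp only [y]
      rw [hadd, h, Nat.mod_self]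
      simp [norm_smul, norm_iterate_map, hs]
  have key (m : ZMod N) : ‖G (phaseEstimationVector N G s m) -
      (ZMod.stdAddChar m : ℂ) • phaseEstimationVector N G s m‖ =
      ‖∑ i, fourierMatrix N m i • y i‖ := by
    have h1 : (ZMod.stdAddChar m : ℂ) • phaseEstimationVector N G s m =
        ∑ i : ZMod N, fourierMatrix N m i •
          ((parabolicWindow N (i + 1).val : ℂ) • G^[(i + 1).val] s) := by
      rw [phaseEstimationVector, ← Equiv.sum_comp (Equiv.addRight (1 : ZMod N)), Finset.smul_sum]
      refine Finset.sum_congr rfl fun i _ => ?_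
      rw [fourierMatrix_apply_eq_mul m i, mul_smul]
      rfl
    rw [h1, phaseEstimationVector, map_sum, ← Finset.sum_sub_distrib]
    congr 1
    refine Finset.sum_congr rfl fun i _ => ?_
    rw [map_smul, map_smul, ← Function.iterate_succ_apply' (⇑G), ← smul_sub]
  simp only [key]
  rw [sum_norm_sq_unitary (fourierMatrix_mem_unitaryGroup N)]
  simp only [hy]
  rw [sum_zmod_val fun t => (parabolicWindow N (t + 1) - parabolicWindow N t) ^ 2,
    sum_parabolicWindow_sub_sq hN]

/-- The amplitude that is read off from the outcome `m` of phase estimation. -/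
def amplitudeEstimate (N : ℕ) [NeZero N] (m : ZMod N) : ℝ := ‖(ZMod.stdAddChar m : ℂ) - 1‖ / 2

/-- Markov's inequality for the defect: a far outcome has defect at least `2ε‖v‖`, by the reverse
triangle inequality applied to `Gv - v` and `ω^m v - v`. -/
theorem sum_norm_sq_amplitudeEstimate_far (hN : 2 ≤ N) (hs : ‖s‖ = 1) {F : ℝ} (hF : 0 ≤ F)
    (h : G (G s) + s = ((2 - 4 * F ^ 2 : ℝ) : ℂ) • G s) {ε : ℝ} (hε : 0 < ε) :
    (∑ m with ε ≤ |amplitudeEstimate N m - F|, ‖phaseEstimationVector N G s m‖ ^ 2) *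
      (4 * ε ^ 2) ≤ 10 / ((N : ℝ) ^ 2 + 1) := by
  rw [← sum_norm_map_sub_smul_sq (G := G) hN hs, Finset.sum_mul]
  refine (Finset.sum_le_sum fun m hm => ?_).trans
    (Finset.sum_le_sum_of_subset_of_nonneg (Finset.subset_univ _) fun _ _ _ => sq_nonneg _)
  set v := phaseEstimationVector N G s m
  have h1 : ‖G v - v‖ = 2 * F * ‖v‖ :=
    norm_map_sub_self_of_quadratic G hF (quadratic_phaseEstimationVector h m)
  have h2 : ‖(ZMod.stdAddChar m : ℂ) • v - v‖ = 2 * amplitudeEstimate N m * ‖v‖ := by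
    rw [amplitudeEstimate, mul_div_cancel₀ _ (two_ne_zero), ← norm_smul, sub_smul, one_smul]
  have h3 := abs_norm_sub_norm_le (G v - v) ((ZMod.stdAddChar m : ℂ) • v - v)
  rw [sub_sub_sub_cancel_right, h1, h2] at h3
  have h4 : 2 * ε * ‖v‖ ≤ ‖G v - (ZMod.stdAddChar m : ℂ) • v‖ := by
    refine le_trans ?_ h3
    rw [← sub_mul, abs_mul, abs_norm, ← mul_sub, abs_mul, abs_two, abs_sub_comm]
    have := (Finset.mem_filter.1 hm).2
    gcongr
  calc ‖v‖ ^ 2 * (4 * ε ^ 2) = (2 * ε * ‖v‖) ^ 2 := by ring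
    _ ≤ _ := by gcongr

theorem two_thirds_le_sum_norm_sq_amplitudeEstimate (hs : ‖s‖ = 1) {F : ℝ} (hF : 0 ≤ F)
    (h : G (G s) + s = ((2 - 4 * F ^ 2 : ℝ) : ℂ) • G s) {ε : ℝ} (hε : 0 < ε) (hε1 : ε < 1)
    (hN : 3 / ε ≤ N) :
    2 / 3 ≤ ∑ m with |amplitudeEstimate N m - F| < ε, ‖phaseEstimationVector N G s m‖ ^ 2 := by
  have h3 : 3 ≤ N * ε := (div_le_iff₀ hε).1 hN
  have hN2 : 2 ≤ N := by
    have : (2 : ℝ) ≤ N := by nlinarith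
    exact_mod_cast this
  have h1 := sum_norm_phaseEstimationVector_sq (G := G) hN2 hs
  have h2 := sum_norm_sq_amplitudeEstimate_far hN2 hs hF h hε
  rw [← Finset.sum_filter_add_sum_filter_not _ (fun m => |amplitudeEstimate N m - F| < ε)] at h1
  simp only [not_lt] at h1
  set bad := ∑ m with ε ≤ |amplitudeEstimate N m - F|, ‖phaseEstimationVector N G s m‖ ^ 2
  suffices bad ≤ 1 / 3 by linarith
  rw [le_div_iff₀ (by positivity)] at h2
  have hb : 0 ≤ bad := Finset.sum_nonneg fun _ _ => sq_nonneg _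
  -- With `h2` this gives `36 * bad ≤ 10`.
  have h5 : 9 ≤ ((N : ℝ) * ε) ^ 2 := by nlinarith
  nlinarith [mul_nonneg hb (sq_nonneg ε)]

end PhaseEstimation

/-! ### Grover iterates -/

section Grover

variable {X : Type} [Fintype X] [DecidableEq X]

/-- The isometry of the Euclidean space given by a unitary matrix. -/
def unitaryIsometry (A : Matrix.unitaryGroup X ℂ) :
    EuclideanSpace ℂ X →ₗᵢ[ℂ] EuclideanSpace ℂ X where
  toLinearMap := Matrix.toEuclideanLin A.val
  norm_map' v := by
    have h := sum_norm_sq_unitary A.2 (fun j => v j)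
    rw [← sq_eq_sq₀ (norm_nonneg _) (norm_nonneg _), EuclideanSpace.norm_sq_eq,
      EuclideanSpace.norm_sq_eq, ← h]
    simp [Matrix.mulVec, dotProduct]

theorem unitaryIsometry_apply (A : Matrix.unitaryGroup X ℂ) (v : X → ℂ) :
    unitaryIsometry A (WithLp.toLp 2 v) = WithLp.toLp 2 (A.val *ᵥ v) := by
  simp [unitaryIsometry]

/-- The diagonal reflection that flips the sign of the basis vectors satisfying `p`. -/
def signFlip (p : X → Prop) [DecidablePred p] : Matrix.unitaryGroup X ℂ :=
  ⟨Matrix.diagonal fun x => if p x then -1 else 1, by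
    rw [Matrix.mem_unitaryGroup_iff, Matrix.star_eq_conjTranspose, Matrix.diagonal_conjTranspose,
      Matrix.diagonal_mul_diagonal, ← Matrix.diagonal_one]
    congr 1
    ext x
    by_cases h : p x <;> simp [h]⟩

variable (W : Matrix.unitaryGroup X ℂ) (x₀ : X) (good : X → Prop) [DecidablePred good]

/-- The Grover iterate of the state preparation `W`, for the marked set `good`. -/
def groverIterate : Matrix.unitaryGroup X ℂ :=
  W * signFlip (fun x => x ≠ x₀) * W⁻¹ * signFlip good

theorem signFlip_ne_mulVec (u : X → ℂ) :
    (signFlip fun x => x ≠ x₀).val *ᵥ u = (2 * u x₀) • Pi.single x₀ 1 - u := by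
  ext x
  rw [signFlip, Matrix.mulVec_diagonal]
  by_cases h : x = x₀
  · subst h; simp; ring
  · simp [h]

theorem reflection_mulVec (u : X → ℂ) :
    (W * signFlip (fun x => x ≠ x₀) * W⁻¹).val *ᵥ u =
      (2 * (star (W.val *ᵥ Pi.single x₀ 1) ⬝ᵥ u)) • (W.val *ᵥ Pi.single x₀ 1) - u := by
  have h1 : (W⁻¹).val = W.valᴴ := rfl
  have h2 : W.val * W.valᴴ = 1 := Matrix.mem_unitaryGroup_iff.1 W.2
  have h3 : (W.valᴴ *ᵥ u) x₀ = star (W.val *ᵥ Pi.single x₀ 1) ⬝ᵥ u := by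
    simp [Matrix.mulVec, dotProduct, Matrix.conjTranspose_apply]
  simp only [Submonoid.coe_mul, h1]
  rw [← Matrix.mulVec_mulVec, ← Matrix.mulVec_mulVec, signFlip_ne_mulVec, Matrix.mulVec_sub,
    Matrix.mulVec_smul, Matrix.mulVec_mulVec, h2, Matrix.one_mulVec, h3]

/-- Cayley–Hamilton on the span of `s` and its good part `p`: the coefficients of `G s` and `G p`
form a 2×2 matrix of trace `2 - 4F²` and determinant 1. The direct computation needs no independence
of `s` and `p`, so `F = 0` and `F = 1` are not special. -/
theorem groverIterate_quadratic {F : ℝ}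
    (hF : ∑ x with good x, ‖(W.val *ᵥ Pi.single x₀ 1) x‖ ^ 2 = F ^ 2) :
    (groverIterate W x₀ good).val *ᵥ
        ((groverIterate W x₀ good).val *ᵥ (W.val *ᵥ Pi.single x₀ 1)) +
        W.val *ᵥ Pi.single x₀ 1 =
      ((2 - 4 * F ^ 2 : ℝ) : ℂ) •
        ((groverIterate W x₀ good).val *ᵥ (W.val *ᵥ Pi.single x₀ 1)) := by
  have hG (u : X → ℂ) : (groverIterate W x₀ good).val *ᵥ u =
      (W * signFlip (fun x => x ≠ x₀) * W⁻¹).val *ᵥ ((signFlip good).val *ᵥ u) := by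
    rw [Matrix.mulVec_mulVec]; rfl
  have hW : star (W.val *ᵥ Pi.single x₀ 1) ⬝ᵥ (W.val *ᵥ Pi.single x₀ 1) = 1 := by
    rw [Matrix.star_mulVec, Matrix.dotProduct_mulVec, Matrix.vecMul_vecMul,
      ← Matrix.star_eq_conjTranspose, Matrix.mem_unitaryGroup_iff'.1 W.2]
    simp
  set s := W.val *ᵥ Pi.single x₀ (1 : ℂ) with hs
  let p : X → ℂ := fun x => if good x then s x else 0
  have hR (u : X → ℂ) : (W * signFlip (fun x => x ≠ x₀) * W⁻¹).val *ᵥ u =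
      (2 * (star s ⬝ᵥ u)) • s - u := reflection_mulVec W x₀ u
  have hsp : star s ⬝ᵥ p = (F : ℂ) ^ 2 := by
    rw [← Complex.ofReal_pow, ← hF, Finset.sum_filter]
    push_cast
    refine Finset.sum_congr rfl fun x _ => ?_
    by_cases h : good x
    · simp [p, h, ← Complex.normSq_eq_norm_sq, Complex.normSq_eq_conj_mul_self]
    · simp [p, h]
  have h1 : (signFlip good).val *ᵥ s = s - (2 : ℂ) • p := by
    ext x
    rw [signFlip, Matrix.mulVec_diagonal]
    by_cases h : good x <;> simp [p, h]; ring
  have h2 : (signFlip good).val *ᵥ p = -p := by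
    ext x
    rw [signFlip, Matrix.mulVec_diagonal]
    by_cases h : good x <;> simp [p, h]
  have hRs : (2 * (star s ⬝ᵥ s)) • s - s = s := by
    rw [hW]; module
  have hGs : (groverIterate W x₀ good).val *ᵥ s = (1 - 4 * (F : ℂ) ^ 2) • s + (2 : ℂ) • p := by
    rw [hG, h1, hR, dotProduct_sub, dotProduct_smul, hW, hsp, smul_eq_mul]
    module
  have hGp : (groverIterate W x₀ good).val *ᵥ p = (-2 * (F : ℂ) ^ 2) • s + p := by
    rw [hG, h2, hR, dotProduct_neg, hsp]
    module
  rw [hGs, Matrix.mulVec_add, Matrix.mulVec_smul, Matrix.mulVec_smul, hGs, hGp]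
  push_cast
  module

end Grover

/-! ### Operators on some of the qubits -/

theorem extend_extend {R Q : Type} (e : R ↪ Q) (r r' : Bits R) (x : Bits Q) :
    Function.extend e r' (Function.extend e r x) = Function.extend e r' x := by
  ext q
  by_cases hq : q ∈ Set.range e
  · obtain ⟨r, rfl⟩ := hq
    simp [e.injective.extend_apply]
  · simp [Function.extend_apply' _ _ _ hq]

theorem conjTranspose_applyOn {R Q : Type} [Fintype Q] [DecidableEq Q] (e : R ↪ Q)
    (M : Matrix (Bits R) (Bits R) ℂ) :
    (applyOn e M)ᴴ = applyOn e Mᴴ := by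
  ext x y
  have : (∀ q, q ∉ Set.range e → y q = x q) ↔ ∀ q, q ∉ Set.range e → x q = y q :=
    forall₂_congr fun _ _ => eq_comm
  simp only [applyOn, Matrix.conjTranspose_apply, Matrix.of_apply]
  by_cases h : ∀ q, q ∉ Set.range e → x q = y q
  · rw [if_pos h, if_pos (this.2 h)]
  · rw [if_neg h, if_neg (mt this.1 h), star_zero]

section ApplyOn

variable {R Q : Type} [Fintype R] [DecidableEq R] [Fintype Q] [DecidableEq Q] (e : R ↪ Q)

theorem applyOn_mulVec (M : Matrix (Bits R) (Bits R) ℂ) (φ : Bits Q → ℂ) (x : Bits Q) :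
    (applyOn e M *ᵥ φ) x = ∑ r, M (x ∘ e) r * φ (Function.extend e r x) := by
  classical
  simp only [Matrix.mulVec, dotProduct, applyOn, Matrix.of_apply, ite_mul, zero_mul]
  rw [← Finset.sum_filter]
  refine Finset.sum_bij' (fun y _ => y ∘ e) (fun r _ => Function.extend e r x) ?_ ?_ ?_ ?_ ?_
  · simp
  · intro r _
    simp only [Finset.mem_filter, Finset.mem_univ, true_and]
    intro q hq
    rw [Function.extend_apply' _ _ _ hq]
  · intro y hy
    have hy := (Finset.mem_filter.1 hy).2
    ext q
    by_cases hq : q ∈ Set.range e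
    · obtain ⟨r, rfl⟩ := hq
      rw [e.injective.extend_apply]; rfl
    · rw [Function.extend_apply' _ _ _ hq, hy q hq]
  · intro r _
    exact Function.extend_comp e.injective r x
  · intro y hy
    have hy := (Finset.mem_filter.1 hy).2
    congr 2
    ext q
    by_cases hq : q ∈ Set.range e
    · obtain ⟨r, rfl⟩ := hq
      rw [e.injective.extend_apply]; rfl
    · rw [Function.extend_apply' _ _ _ hq, hy q hq]

theorem applyOn_mulVec_applyOn_mulVec (M N : Matrix (Bits R) (Bits R) ℂ) (φ : Bits Q → ℂ) :
    applyOn e M *ᵥ (applyOn e N *ᵥ φ) = applyOn e (M * N) *ᵥ φ := by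
  ext x
  simp only [applyOn_mulVec, Function.extend_comp e.injective, extend_extend, Matrix.mul_apply,
    Finset.mul_sum, Finset.sum_mul, mul_assoc]
  exact Finset.sum_comm

theorem applyOn_one_mulVec (φ : Bits Q → ℂ) :
    applyOn e (1 : Matrix (Bits R) (Bits R) ℂ) *ᵥ φ = φ := by
  ext x
  simp only [applyOn_mulVec, Matrix.one_apply, ite_mul, one_mul, zero_mul, Finset.sum_ite_eq,
    Finset.mem_univ, if_true]
  congr 1
  ext q
  by_cases hq : q ∈ Set.range e
  · obtain ⟨r, rfl⟩ := hq
    rw [e.injective.extend_apply]; rfl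
  · rw [Function.extend_apply' _ _ _ hq]

/-- The unitary on the register `Q` that applies `U` to the qubits `e r`. -/
def unitaryOn (U : QUnitary R) : QUnitary Q :=
  ⟨applyOn e U.val, by
    rw [Matrix.mem_unitaryGroup_iff, Matrix.star_eq_conjTranspose, conjTranspose_applyOn]
    refine Matrix.ext_of_mulVec_single fun i => ?_
    rw [← Matrix.mulVec_mulVec, applyOn_mulVec_applyOn_mulVec, ← Matrix.star_eq_conjTranspose,
      Matrix.mem_unitaryGroup_iff.1 U.2, applyOn_one_mulVec, Matrix.one_mulVec]⟩

theorem unitaryOn_inv (U : QUnitary R) : (unitaryOn e U)⁻¹ = unitaryOn e U⁻¹ :=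
  Subtype.ext (conjTranspose_applyOn e U.val)

theorem applyOn_oracleMatrix (U : QUnitary R) (inv : Bool) :
    applyOn e (oracleMatrix inv U) = (unitaryOn e (if inv then U⁻¹ else U)).val := by
  cases inv <;> rfl

end ApplyOn

/-! ### Fidelity with a pure state -/

theorem ketBra_nonneg {Q : Type} [Fintype Q] (ψ : Bits Q → ℂ) : 0 ≤ ketBra ψ :=
  (Matrix.posSemidef_vecMulVec_self_star ψ).nonneg

section Fidelity

variable {Q : Type} [Fintype Q] [DecidableEq Q]

theorem star_dotProduct_self_of_isPureState {ψ : Bits Q → ℂ} (hψ : IsPureState ψ) :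
    star ψ ⬝ᵥ ψ = 1 := by
  have h : ((∑ x, ‖ψ x‖ ^ 2 : ℝ) : ℂ) = 1 := by rw [hψ]; simp
  rw [← h]
  push_cast
  refine Finset.sum_congr rfl fun x _ => ?_
  exact Complex.conj_mul' (ψ x)

theorem ketBra_mul_mul_ketBra (ψ : Bits Q → ℂ) (ρ : Matrix (Bits Q) (Bits Q) ℂ) :
    ketBra ψ * ρ * ketBra ψ = (star ψ ⬝ᵥ (ρ *ᵥ ψ)) • ketBra ψ := by
  rw [ketBra, mul_assoc, Matrix.mul_vecMulVec, Matrix.vecMulVec_mul_vecMulVec]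
  simp

theorem sqrt_smul_ketBra {ψ : Bits Q → ℂ} (hψ : IsPureState ψ) {r : ℝ} (hr : 0 ≤ r) :
    CFC.sqrt ((r : ℂ) • ketBra ψ) = ((√r : ℝ) : ℂ) • ketBra ψ := by
  refine CFC.sqrt_unique ?_ (smul_nonneg (by exact_mod_cast Real.sqrt_nonneg r) (ketBra_nonneg ψ))
  have h := ketBra_mul_mul_ketBra ψ 1
  rw [mul_one, Matrix.one_mulVec, star_dotProduct_self_of_isPureState hψ, one_smul] at h
  rw [smul_mul_smul_comm, h, ← Complex.ofReal_mul, Real.mul_self_sqrt hr]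

/-- A rank-one projection is its own square root, and sandwiching `ρ` with it leaves the scalar
`⟨ψ|ρ|ψ⟩` times the projection. -/
theorem fidelity_ketBra {ψ : Bits Q → ℂ} (hψ : IsPureState ψ) {ρ : Matrix (Bits Q) (Bits Q) ℂ}
    (hρ : ρ.PosSemidef) : fidelity ρ (ketBra ψ) = √(star ψ ⬝ᵥ (ρ *ᵥ ψ)).re := by
  have h0 := hρ.dotProduct_mulVec_nonneg ψ
  have hc : star ψ ⬝ᵥ (ρ *ᵥ ψ) = ((star ψ ⬝ᵥ (ρ *ᵥ ψ)).re : ℂ) :=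
    Complex.ext rfl (by simpa using (Complex.nonneg_iff.1 h0).2.symm)
  have h1 : CFC.sqrt (ketBra ψ) = ketBra ψ := by
    simpa using sqrt_smul_ketBra hψ zero_le_one
  have h2 : (ketBra ψ).trace = 1 := by
    rw [ketBra, Matrix.trace_vecMulVec, dotProduct_comm, star_dotProduct_self_of_isPureState hψ]
  rw [fidelity, h1, ketBra_mul_mul_ketBra, hc, sqrt_smul_ketBra hψ (Complex.nonneg_iff.1 h0).1,
    Matrix.trace_smul, h2]
  simp

end Fidelity

/-! ### Product states -/

section Product

variable {A B : Type}

theorem sum_bits_sum {M : Type*} [AddCommMonoid M] [Fintype A] [DecidableEq A] [Fintype B]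
    [DecidableEq B] (f : Bits (A ⊕ B) → M) :
    ∑ x, f x = ∑ y : Bits A, ∑ z : Bits B, f (Sum.elim y z) := by
  rw [← Fintype.sum_prod_type']
  exact Fintype.sum_equiv (Equiv.sumArrowEquivProdArrow A B Bool) _ _ fun x => by
    simp [Equiv.sumArrowEquivProdArrow]

theorem extend_inl (r : Bits A) (x : Bits (A ⊕ B)) :
    Function.extend (Function.Embedding.inl : A ↪ A ⊕ B) r x = Sum.elim r (x ∘ Sum.inr) := by
  ext (q | q)
  · exact (Function.Embedding.inl : A ↪ A ⊕ B).injective.extend_apply _ _ _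
  · rw [Function.extend_apply' _ _ _ (by simp)]; rfl

theorem extend_inr (r : Bits B) (x : Bits (A ⊕ B)) :
    Function.extend (Function.Embedding.inr : B ↪ A ⊕ B) r x = Sum.elim (x ∘ Sum.inl) r := by
  ext (q | q)
  · rw [Function.extend_apply' _ _ _ (by simp)]; rfl
  · exact (Function.Embedding.inr : B ↪ A ⊕ B).injective.extend_apply _ _ _

variable [Fintype A] [DecidableEq A] [Fintype B] [DecidableEq B]

theorem zeroKet_sum : zeroKet (A ⊕ B) = tensorKet (zeroKet A) (zeroKet B) := by
  ext x
  simp only [zeroKet, tensorKet, Pi.single_apply]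
  have : x = (fun _ => false) ↔ x ∘ Sum.inl = (fun _ => false) ∧ x ∘ Sum.inr = fun _ => false := by
    simp [funext_iff]
  simp only [this, ite_and]
  split_ifs <;> simp

theorem applyOn_inl_mulVec_tensorKet (M : Matrix (Bits A) (Bits A) ℂ) (φ : Bits A → ℂ)
    (χ : Bits B → ℂ) :
    applyOn Function.Embedding.inl M *ᵥ tensorKet φ χ = tensorKet (M *ᵥ φ) χ := by
  ext x
  rw [applyOn_mulVec]
  simp only [extend_inl, tensorKet, Sum.elim_comp_inl, Sum.elim_comp_inr, ← mul_assoc,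
    ← Finset.sum_mul]
  rfl

theorem applyOn_inr_mulVec_tensorKet (M : Matrix (Bits B) (Bits B) ℂ) (φ : Bits A → ℂ)
    (χ : Bits B → ℂ) :
    applyOn Function.Embedding.inr M *ᵥ tensorKet φ χ = tensorKet φ (M *ᵥ χ) := by
  ext x
  rw [applyOn_mulVec]
  simp only [extend_inr, tensorKet, Sum.elim_comp_inl, Sum.elim_comp_inr, mul_left_comm,
    ← Finset.mul_sum]
  rfl

end Product

/-! ### A state preparation whose good amplitude is the fidelity -/

section Overlap

variable {A B C : Type}

/-- The qubits of `A` and of the redundant register of `V`. -/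
def crossEmbedding (A B C : Type) : A ⊕ C ↪ (A ⊕ B) ⊕ (A ⊕ C) :=
  ⟨Sum.map Sum.inl Sum.inr, Sum.map_injective.2 ⟨Sum.inl_injective, Sum.inr_injective⟩⟩

theorem extend_crossEmbedding (r : Bits (A ⊕ C)) (x : Bits ((A ⊕ B) ⊕ (A ⊕ C))) :
    Function.extend (crossEmbedding A B C) r x =
      Sum.elim (Sum.elim (r ∘ Sum.inl) (x ∘ Sum.inl ∘ Sum.inr))
        (Sum.elim (x ∘ Sum.inr ∘ Sum.inl) (r ∘ Sum.inr)) := by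
  ext ((q | q) | (q | q))
  · exact (crossEmbedding A B C).injective.extend_apply _ _ (Sum.inl q)
  · rw [Function.extend_apply' _ _ _ (by simp [crossEmbedding])]; rfl
  · rw [Function.extend_apply' _ _ _ (by simp [crossEmbedding])]; rfl
  · exact (crossEmbedding A B C).injective.extend_apply _ _ (Sum.inr q)

variable [Fintype A] [DecidableEq A] [Fintype B] [DecidableEq B] [Fintype C] [DecidableEq C]

/-- Prepare `|ρ⟩` and `|ψ⟩|ψ'⟩`, exchange the roles of the two copies of `A`, and undo `V`. -/
def overlapPreparation (U : QUnitary (A ⊕ B)) (V : QUnitary (A ⊕ C)) :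
    QUnitary ((A ⊕ B) ⊕ (A ⊕ C)) :=
  unitaryOn (crossEmbedding A B C) V⁻¹ * unitaryOn Function.Embedding.inr V *
    unitaryOn Function.Embedding.inl U

/-- The zero row of `V⁻¹` is `⟨ψ|⟨ψ'|`. It contracts `ψ` with register A of the purification and
`ψ'` with itself, leaving `ψ` on A'. -/
theorem overlapPreparation_apply {U : QUnitary (A ⊕ B)} {V : QUnitary (A ⊕ C)} {ψ : Bits A → ℂ}
    {ψ' : Bits C → ℂ} (hψ' : IsPureState ψ')
    (hV : V.val *ᵥ zeroKet (A ⊕ C) = tensorKet ψ ψ') {x : Bits ((A ⊕ B) ⊕ (A ⊕ C))}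
    (hx : x ∘ crossEmbedding A B C = fun _ => false) :
    ((overlapPreparation U V).val *ᵥ zeroKet _) x =
      (∑ p, star (ψ p) * (U.val *ᵥ zeroKet (A ⊕ B)) (Sum.elim p (x ∘ Sum.inl ∘ Sum.inr))) *
        ψ (x ∘ Sum.inr ∘ Sum.inl) := by
  have hVinv (r : Bits (A ⊕ C)) :
      (V⁻¹).val (fun _ => false) r = star (tensorKet ψ ψ' r) := by
    rw [← hV, zeroKet, Matrix.mulVec_single_one]; rfl
  have h1 := star_dotProduct_self_of_isPureState hψ'
  have h2 : (overlapPreparation U V).val *ᵥ zeroKet _ =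
      applyOn (crossEmbedding A B C) (V⁻¹).val *ᵥ
        tensorKet (U.val *ᵥ zeroKet (A ⊕ B)) (tensorKet ψ ψ') := by
    rw [overlapPreparation, Submonoid.coe_mul, Submonoid.coe_mul, ← Matrix.mulVec_mulVec,
      ← Matrix.mulVec_mulVec, zeroKet_sum]
    simp only [unitaryOn]
    rw [applyOn_inl_mulVec_tensorKet, applyOn_inr_mulVec_tensorKet, hV]
  rw [h2, applyOn_mulVec, hx, sum_bits_sum]
  simp only [hVinv, extend_crossEmbedding, tensorKet, Sum.elim_comp_inl, Sum.elim_comp_inr]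
  rw [Finset.sum_mul]
  refine Finset.sum_congr rfl fun p _ => ?_
  rw [← mul_one (_ * ψ _), ← h1, dotProduct, Finset.mul_sum]
  refine Finset.sum_congr rfl fun c _ => ?_
  simp only [star_mul, Pi.star_apply]
  ring

theorem star_dotProduct_partialTraceB_ketBra (ψ : Bits A → ℂ) (u : Bits (A ⊕ B) → ℂ) :
    star ψ ⬝ᵥ (partialTraceB (ketBra u) *ᵥ ψ) =
      ((∑ q : Bits B, ‖∑ p, star (ψ p) * u (Sum.elim p q)‖ ^ 2 : ℝ) : ℂ) := by
  let f (p p' : Bits A) (q : Bits B) : ℂ :=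
    star (ψ p) * u (Sum.elim p q) * star (star (ψ p') * u (Sum.elim p' q))
  calc _ = ∑ p, ∑ p', ∑ q : Bits B, f p p' q := by
        simp only [dotProduct, Matrix.mulVec, Finset.mul_sum]
        refine Finset.sum_congr rfl fun p _ => Finset.sum_congr rfl fun p' _ => ?_
        rw [partialTraceB, Matrix.of_apply, Finset.sum_mul, Finset.mul_sum]
        refine Finset.sum_congr rfl fun q _ => ?_
        simp only [f, ketBra, Matrix.vecMulVec_apply, Pi.star_apply, star_mul, star_star]
        ring
    _ = ∑ p, ∑ q : Bits B, ∑ p', f p p' q := Finset.sum_congr rfl fun p _ => Finset.sum_comm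
    _ = ∑ q : Bits B, ∑ p, ∑ p', f p p' q := Finset.sum_comm
    _ = _ := by
        push_cast
        refine Finset.sum_congr rfl fun q _ => ?_
        rw [← Complex.mul_conj', map_sum, Finset.sum_mul_sum]
        rfl

theorem sum_norm_sq_overlapPreparation {U : QUnitary (A ⊕ B)} {V : QUnitary (A ⊕ C)}
    {ρ : Matrix (Bits A) (Bits A) ℂ} {ψ : Bits A → ℂ} (hψ : IsPureState ψ)
    (hU : PreparesMixed U ρ) (hV : PreparesPure V ψ) :
    ∑ x with x ∘ crossEmbedding A B C = fun _ => false,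
      ‖((overlapPreparation U V).val *ᵥ zeroKet _) x‖ ^ 2 = (star ψ ⬝ᵥ (ρ *ᵥ ψ)).re := by
  obtain ⟨ψ', hψ', hV⟩ := hV
  set u := U.val *ᵥ zeroKet (A ⊕ B) with hu
  let c (q : Bits B) : ℂ := ∑ p, star (ψ p) * u (Sum.elim p q)
  have hgood (p : Bits A) (q : Bits B) (r : Bits A) (t : Bits C) :
      Sum.elim (Sum.elim p q) (Sum.elim r t) ∘ crossEmbedding A B C = (fun _ => false) ↔
        t = (fun _ => false) ∧ p = fun _ => false := by
    simp [funext_iff, crossEmbedding, and_comm]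
  have h1 : ∑ x with x ∘ crossEmbedding A B C = fun _ => false,
      ‖((overlapPreparation U V).val *ᵥ zeroKet _) x‖ ^ 2 = ∑ q, ‖c q‖ ^ 2 := by
    calc _ = ∑ x : Bits ((A ⊕ B) ⊕ (A ⊕ C)), if x ∘ crossEmbedding A B C = fun _ => false then
          ‖c (x ∘ Sum.inl ∘ Sum.inr) * ψ (x ∘ Sum.inr ∘ Sum.inl)‖ ^ 2 else 0 := by
          rw [Finset.sum_filter]
          refine Finset.sum_congr rfl fun x _ => ?_
          split_ifs with hx
          · rw [overlapPreparation_apply hψ' hV hx]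
          · rfl
      _ = ∑ p : Bits A, ∑ q : Bits B, ∑ r : Bits A, ∑ t : Bits C,
          if t = (fun _ => false) then if p = fun _ => false then ‖c q‖ ^ 2 * ‖ψ r‖ ^ 2
            else 0 else 0 := by
          simp only [sum_bits_sum, hgood, ite_and, norm_mul, mul_pow]
          rfl
      _ = ∑ q, ‖c q‖ ^ 2 := by
          rw [Finset.sum_comm]
          refine Finset.sum_congr rfl fun q _ => ?_
          simp only [Finset.sum_ite_eq', Finset.mem_univ, if_true]
          rw [Finset.sum_comm]
          simp only [Finset.sum_ite_eq', Finset.mem_univ, if_true]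
          rw [← Finset.mul_sum, hψ, mul_one]
  rw [h1]
  rw [hU, star_dotProduct_partialTraceB_ketBra, Complex.ofReal_re]

end Overlap

/-! ### Slicing the work register along the phase register -/

section Slice

variable {P T : Type}

/-- The component of `φ` in which the second register is in the basis state `j`. -/
def slice (φ : Bits (P ⊕ T) → ℂ) (j : Bits T) : Bits P → ℂ := fun x => φ (Sum.elim x j)

theorem sum_norm_sq_slice [Fintype P] [DecidableEq P] [Fintype T] [DecidableEq T]
    (φ : Bits (P ⊕ T) → ℂ) (p : Bits T → Prop) [DecidablePred p] :
    ∑ z : Bits (P ⊕ T), (if p (z ∘ Sum.inr) then ‖φ z‖ ^ 2 else 0) =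
      ∑ j with p j, ∑ x, ‖slice φ j x‖ ^ 2 := by
  rw [sum_bits_sum, Finset.sum_comm, Finset.sum_filter]
  refine Finset.sum_congr rfl fun j _ => ?_
  change ∑ x : Bits P, (if p j then ‖φ (Sum.elim x j)‖ ^ 2 else 0) = _
  split_ifs <;> simp [slice]

theorem slice_ext {φ χ : Bits (P ⊕ T) → ℂ} (h : ∀ j, slice φ j = slice χ j) : φ = χ := by
  ext z
  have := congrFun (h (z ∘ Sum.inr)) (z ∘ Sum.inl)
  simpa [slice] using this

theorem slice_tensorKet (φ : Bits P → ℂ) (χ : Bits T → ℂ) (j : Bits T) :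
    slice (tensorKet φ χ) j = χ j • φ := by
  ext x
  simp [slice, tensorKet, mul_comm]

variable [Fintype P] [DecidableEq P] [Fintype T] [DecidableEq T]

/-- Gates off the phase register act on every slice separately, so the circuit can be analysed for
each phase label. -/
theorem slice_applyOn_trans_inl {R : Type} [Fintype R] [DecidableEq R] (e : R ↪ P)
    (M : Matrix (Bits R) (Bits R) ℂ) (φ : Bits (P ⊕ T) → ℂ) (j : Bits T) :
    slice (applyOn (e.trans Function.Embedding.inl) M *ᵥ φ) j = applyOn e M *ᵥ slice φ j := by
  ext x
  rw [slice, applyOn_mulVec, applyOn_mulVec]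
  refine Finset.sum_congr rfl fun r _ => ?_
  have h : Function.extend (e.trans (Function.Embedding.inl : P ↪ P ⊕ T)) r (Sum.elim x j) =
      Sum.elim (Function.extend e r x) j := by
    ext (q | q)
    · by_cases hq : q ∈ Set.range e
      · obtain ⟨i, rfl⟩ := hq
        exact ((e.trans (Function.Embedding.inl : P ↪ P ⊕ T)).injective.extend_apply _ _ i).trans
          (e.injective.extend_apply _ _ i).symm
      · rw [Function.extend_apply' _ _ _ (by simpa using hq)]
        exact (Function.extend_apply' _ _ _ hq).symm
    · rw [Function.extend_apply' _ _ _ (by simp)]; rfl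
  rw [h]
  rfl

theorem slice_applyOn_inr (M : Matrix (Bits T) (Bits T) ℂ) (φ : Bits (P ⊕ T) → ℂ) (j : Bits T) :
    slice (applyOn Function.Embedding.inr M *ᵥ φ) j = ∑ r, M j r • slice φ r := by
  ext x
  rw [slice, applyOn_mulVec, Finset.sum_apply]
  simp only [extend_inr]
  rfl

/-- The block matrix that applies `M j` when the second register is in the basis state `j`. -/
def blockMatrix (M : Bits T → Matrix (Bits P) (Bits P) ℂ) :
    Matrix (Bits (P ⊕ T)) (Bits (P ⊕ T)) ℂ :=
  Matrix.of fun x y =>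
    if x ∘ Sum.inr = y ∘ Sum.inr then M (x ∘ Sum.inr) (x ∘ Sum.inl) (y ∘ Sum.inl) else 0

theorem blockMatrix_elim (M : Bits T → Matrix (Bits P) (Bits P) ℂ) (x y : Bits P) (j l : Bits T) :
    blockMatrix M (Sum.elim x j) (Sum.elim y l) = if j = l then M j x y else 0 :=
  rfl

theorem slice_blockMatrix (M : Bits T → Matrix (Bits P) (Bits P) ℂ) (φ : Bits (P ⊕ T) → ℂ)
    (j : Bits T) : slice (blockMatrix M *ᵥ φ) j = M j *ᵥ slice φ j := by
  ext x
  simp only [slice, Matrix.mulVec, dotProduct, sum_bits_sum, blockMatrix_elim, ite_mul, zero_mul,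
    Finset.sum_ite_eq, Finset.mem_univ, if_true]

/-- The unitary that applies `M j` when the second register is in the basis state `j`. -/
def blockUnitary (M : Bits T → QUnitary P) : QUnitary (P ⊕ T) :=
  ⟨blockMatrix fun j => (M j).val, by
    have h : (blockMatrix fun j => (M j).val)ᴴ = blockMatrix fun j => (M j).valᴴ := by
      ext x y
      simp only [blockMatrix, Matrix.conjTranspose_apply, Matrix.of_apply]
      by_cases hxy : y ∘ Sum.inr = x ∘ Sum.inr
      · simp [hxy]
      · simp [hxy, Ne.symm hxy]
    rw [Matrix.mem_unitaryGroup_iff, Matrix.star_eq_conjTranspose, h]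
    refine Matrix.ext_of_mulVec_single fun i => slice_ext fun j => ?_
    rw [← Matrix.mulVec_mulVec, slice_blockMatrix, slice_blockMatrix, Matrix.mulVec_mulVec,
      ← Matrix.star_eq_conjTranspose, Matrix.mem_unitaryGroup_iff.1 (M j).2, Matrix.one_mulVec,
      Matrix.one_mulVec]⟩

theorem slice_blockUnitary (M : Bits T → QUnitary P) (φ : Bits (P ⊕ T) → ℂ) (j : Bits T) :
    slice ((blockUnitary M).val *ᵥ φ) j = (M j).val *ᵥ slice φ j :=
  slice_blockMatrix _ φ j

end Slice

/-! ### Oracle-independent unitaries on the phase register -/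

/-- Extend `φ`, placed at index `x₀`, to an orthonormal basis and take the change-of-basis matrix.
-/
theorem exists_unitary_mulVec_single {X : Type} [Fintype X] [DecidableEq X] (x₀ : X) {φ : X → ℂ}
    (hφ : ∑ x, ‖φ x‖ ^ 2 = 1) :
    ∃ A : Matrix.unitaryGroup X ℂ, A.val *ᵥ Pi.single x₀ 1 = φ := by
  have hnorm : ‖WithLp.toLp 2 φ‖ = 1 := by
    rw [EuclideanSpace.norm_eq, Real.sqrt_eq_one]
    exact hφ
  have horth : Orthonormal ℂ
      (({x₀} : Set X).domRestrict fun _ => (WithLp.toLp 2 φ : EuclideanSpace ℂ X)) := by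
    refine ⟨fun _ => hnorm, fun i j hij => absurd (Subsingleton.elim i j) hij⟩
  obtain ⟨b, hb⟩ := horth.exists_orthonormalBasis_extension_of_card_eq (by simp)
  refine ⟨⟨(EuclideanSpace.basisFun X ℂ).toBasis.toMatrix b,
    (EuclideanSpace.basisFun X ℂ).toMatrix_orthonormalBasis_mem_unitary b⟩, ?_⟩
  ext x
  rw [Matrix.mulVec_single_one]
  simp [Matrix.col, Module.Basis.toMatrix_apply, hb x₀ rfl]

/-- The Fourier transform on a register whose basis labels are identified with `ZMod N`. -/
def fourierUnitary {X : Type} [Fintype X] [DecidableEq X] {N : ℕ} [NeZero N] (τ : X ≃ ZMod N) :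
    Matrix.unitaryGroup X ℂ :=
  ⟨(fourierMatrix N).submatrix τ τ, by
    rw [Matrix.mem_unitaryGroup_iff, Matrix.star_eq_conjTranspose, Matrix.conjTranspose_submatrix,
      Matrix.submatrix_mul_equiv, ← Matrix.star_eq_conjTranspose,
      Matrix.mem_unitaryGroup_iff.1 (fourierMatrix_mem_unitaryGroup N), Matrix.submatrix_one_equiv]⟩

/-! ### The algorithm -/

section Algorithm

variable {A B C T : Type} [Fintype A] [DecidableEq A] [Fintype B] [DecidableEq B]
  [Fintype C] [DecidableEq C] [Fintype T] [DecidableEq T]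

/-- The operator performed by a list of gates. -/
def runGates {R S Q : Type} [Fintype R] [DecidableEq R] [Fintype S] [DecidableEq S] [Fintype Q]
    [DecidableEq Q] (U : QUnitary R) (V : QUnitary S) (gs : List (QGate R S Q))
    (φ : Bits Q → ℂ) : Bits Q → ℂ :=
  gs.foldl (fun v g => g.toMatrix U V *ᵥ v) φ

variable (A B C T) in
/-- The gates that perform `overlapPreparation`. -/
def prepareGates : List (QGate (A ⊕ B) (A ⊕ C) (((A ⊕ B) ⊕ (A ⊕ C)) ⊕ T)) :=
  [.queryU false (Function.Embedding.inl.trans .inl),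
    .queryV false (Function.Embedding.inr.trans .inl),
    .queryV true ((crossEmbedding A B C).trans .inl)]

variable (A B C T) in
/-- The gates that perform the inverse of `overlapPreparation`. -/
def unprepareGates : List (QGate (A ⊕ B) (A ⊕ C) (((A ⊕ B) ⊕ (A ⊕ C)) ⊕ T)) :=
  [.queryV false ((crossEmbedding A B C).trans .inl),
    .queryV true (Function.Embedding.inr.trans .inl),
    .queryU true (Function.Embedding.inl.trans .inl)]

variable (A B C) in
/-- The basis labels on which the cross register is in the zero state. -/
abbrev CrossZero (x : Bits ((A ⊕ B) ⊕ (A ⊕ C))) : Prop :=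
  x ∘ crossEmbedding A B C = fun _ => false

variable (A B C) in
/-- The gates of the Grover iterate, controlled on the condition `c` of the phase register. -/
def groverGates (c : Bits T → Prop) [DecidablePred c] :
    List (QGate (A ⊕ B) (A ⊕ C) (((A ⊕ B) ⊕ (A ⊕ C)) ⊕ T)) :=
  [.free (blockUnitary fun j => if c j then signFlip (CrossZero A B C) else 1)] ++
    unprepareGates A B C T ++
    [.free (blockUnitary fun j => if c j then signFlip (fun x => x ≠ fun _ => false) else 1)] ++
    prepareGates A B C T

variable (A B C) in
/-- The gates of amplitude estimation of the overlap, with the phase register prepared by `D`. -/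
def fidelityEstimationGates {N : ℕ} [NeZero N] (τ : Bits T ≃ ZMod N) (D : QUnitary T) :
    List (QGate (A ⊕ B) (A ⊕ C) (((A ⊕ B) ⊕ (A ⊕ C)) ⊕ T)) :=
  [.free (unitaryOn Function.Embedding.inr D)] ++ prepareGates A B C T ++
    (List.range N).flatMap (fun t => groverGates A B C fun j => t < (τ j).val) ++
    [.free (unitaryOn Function.Embedding.inr (fourierUnitary τ))]

/-- Amplitude estimation of the overlap, with the phase register prepared by `D`. -/
def fidelityEstimation {N : ℕ} [NeZero N] (τ : Bits T ≃ ZMod N) (D : QUnitary T) :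
    QueryAlgorithm (A ⊕ B) (A ⊕ C) where
  Qubit := ((A ⊕ B) ⊕ (A ⊕ C)) ⊕ T
  fintypeQubit := inferInstance
  decEqQubit := inferInstance
  gates := fidelityEstimationGates A B C τ D
  output z := amplitudeEstimate N (τ (z ∘ Sum.inr))

theorem queries_fidelityEstimation {N : ℕ} [NeZero N] (τ : Bits T ≃ ZMod N) (D : QUnitary T) :
    (fidelityEstimation (A := A) (B := B) (C := C) τ D).queries = 3 + 6 * N := by
  have h : ∀ n, (((List.range n).flatMap fun t =>
      groverGates A B C fun j => t < (τ j).val).map QGate.queries).sum = 6 * n := by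
    intro n
    induction n with
    | zero => rfl
    | succ n ih =>
      rw [List.range_succ, List.flatMap_append, List.map_append, List.sum_append, ih]
      simp [groverGates, prepareGates, unprepareGates, QGate.queries]
      ring
  rw [QueryAlgorithm.queries, fidelityEstimation, fidelityEstimationGates]
  simp only [List.map_append, List.sum_append, h]
  simp [prepareGates, QGate.queries]

variable (U : QUnitary (A ⊕ B)) (V : QUnitary (A ⊕ C))

theorem slice_runGates_prepareGates (φ : Bits (((A ⊕ B) ⊕ (A ⊕ C)) ⊕ T) → ℂ) (j : Bits T) :
    slice (runGates U V (prepareGates A B C T) φ) j =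
      (overlapPreparation U V).val *ᵥ slice φ j := by
  simp only [runGates, prepareGates, List.foldl_cons, List.foldl_nil, QGate.toMatrix,
    slice_applyOn_trans_inl]
  simp only [applyOn_oracleMatrix, overlapPreparation, Submonoid.coe_mul,
    ← Matrix.mulVec_mulVec]
  rfl

theorem slice_runGates_unprepareGates (φ : Bits (((A ⊕ B) ⊕ (A ⊕ C)) ⊕ T) → ℂ) (j : Bits T) :
    slice (runGates U V (unprepareGates A B C T) φ) j =
      (overlapPreparation U V)⁻¹.val *ᵥ slice φ j := by
  simp only [runGates, unprepareGates, List.foldl_cons, List.foldl_nil, QGate.toMatrix,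
    slice_applyOn_trans_inl]
  simp only [applyOn_oracleMatrix, overlapPreparation, mul_inv_rev, unitaryOn_inv,
    inv_inv, Submonoid.coe_mul, ← Matrix.mulVec_mulVec]
  rfl

theorem runGates_append {R S Q : Type} [Fintype R] [DecidableEq R] [Fintype S] [DecidableEq S]
    [Fintype Q] [DecidableEq Q] (U : QUnitary R) (V : QUnitary S) (gs gs' : List (QGate R S Q))
    (φ : Bits Q → ℂ) : runGates U V (gs ++ gs') φ = runGates U V gs' (runGates U V gs φ) :=
  List.foldl_append

theorem runGates_free {R S Q : Type} [Fintype R] [DecidableEq R] [Fintype S] [DecidableEq S]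
    [Fintype Q] [DecidableEq Q] (U : QUnitary R) (V : QUnitary S) (G : QUnitary Q)
    (φ : Bits Q → ℂ) : runGates U V [.free G] φ = G.val *ᵥ φ :=
  rfl

/-- Only the two reflections need control: when they are switched off, `W⁻¹` and `W` cancel. Hence
the oracles are queried without control. -/
theorem slice_runGates_groverGates (c : Bits T → Prop) [DecidablePred c]
    (φ : Bits (((A ⊕ B) ⊕ (A ⊕ C)) ⊕ T) → ℂ) (j : Bits T) :
    slice (runGates U V (groverGates A B C c) φ) j =
      if c j then (groverIterate (overlapPreparation U V) (fun _ => false)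
        (CrossZero A B C)).val *ᵥ slice φ j else slice φ j := by
  simp only [groverGates, runGates_append, runGates_free, slice_runGates_prepareGates,
    slice_runGates_unprepareGates, slice_blockUnitary]
  split_ifs
  · simp only [groverIterate, Submonoid.coe_mul, ← Matrix.mulVec_mulVec]
  · rw [Submonoid.coe_one, Matrix.one_mulVec, Matrix.one_mulVec, Matrix.mulVec_mulVec,
      ← Submonoid.coe_mul, mul_inv_cancel, Submonoid.coe_one, Matrix.one_mulVec]

/-- Round `t` acts on the slices with `t < f j`, so label `j` collects one Grover iterate per round
until it has `f j` of them. -/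
theorem slice_runGates_flatMap_groverGates (f : Bits T → ℕ) (n : ℕ)
    (φ : Bits (((A ⊕ B) ⊕ (A ⊕ C)) ⊕ T) → ℂ) (j : Bits T) :
    slice (runGates U V ((List.range n).flatMap fun t => groverGates A B C fun j => t < f j) φ) j =
      (fun u => (groverIterate (overlapPreparation U V) (fun _ => false)
        (CrossZero A B C)).val *ᵥ u)^[min n (f j)] (slice φ j) := by
  induction n with
  | zero => simp [runGates]
  | succ n ih =>
    rw [List.range_succ, List.flatMap_append, runGates_append, List.flatMap_singleton,
      slice_runGates_groverGates, ih]
    split_ifs with h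
    · rw [min_eq_left h.le, min_eq_left h, Function.iterate_succ_apply']
    · rw [min_eq_right (not_lt.1 h), min_eq_right ((not_lt.1 h).trans n.le_succ)]

theorem slice_runGates_fidelityEstimationGates {N : ℕ} [NeZero N] (τ : Bits T ≃ ZMod N)
    {D : QUnitary T} (hD : D.val *ᵥ zeroKet T = fun j => (parabolicWindow N (τ j).val : ℂ))
    (j : Bits T) :
    WithLp.toLp 2 (slice (runGates U V (fidelityEstimationGates A B C τ D) (zeroKet _)) j) =
      phaseEstimationVector N (unitaryIsometry (groverIterate (overlapPreparation U V)
        (fun _ => false) (CrossZero A B C)))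
        (WithLp.toLp 2 ((overlapPreparation U V).val *ᵥ zeroKet _)) (τ j) := by
  set G := groverIterate (overlapPreparation U V) (fun _ => false) (CrossZero A B C) with hG
  have hiter (t : ℕ) (u : Bits ((A ⊕ B) ⊕ (A ⊕ C)) → ℂ) (a : ℂ) :
      WithLp.toLp 2 ((fun u => G.val *ᵥ u)^[t] (a • u)) =
        a • (unitaryIsometry G)^[t] (WithLp.toLp 2 u) := by
    induction t with
    | zero => rfl
    | succ t ih =>
      rw [Function.iterate_succ_apply', Function.iterate_succ_apply', ← unitaryIsometry_apply, ih,
        map_smul]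
  simp only [fidelityEstimationGates, runGates_append, runGates_free]
  simp only [unitaryOn]
  rw [slice_applyOn_inr]
  simp only [slice_runGates_flatMap_groverGates, slice_runGates_prepareGates]
  rw [zeroKet_sum, applyOn_inr_mulVec_tensorKet, hD]
  simp only [slice_tensorKet, Matrix.mulVec_smul]
  rw [phaseEstimationVector, ← Equiv.sum_comp τ, WithLp.toLp_sum]
  refine Finset.sum_congr rfl fun r _ => ?_
  rw [WithLp.toLp_smul, ← hG, hiter, min_eq_right (ZMod.val_lt _).le]
  rfl

theorem two_thirds_le_outputProb_fidelityEstimation {N : ℕ} [NeZero N] (τ : Bits T ≃ ZMod N)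
    {D : QUnitary T} (hD : D.val *ᵥ zeroKet T = fun j => (parabolicWindow N (τ j).val : ℂ))
    {ε : ℝ} (hε : 0 < ε) (hε1 : ε < 1) (hN : 3 / ε ≤ N) {F : ℝ} (hF : 0 ≤ F)
    (h : ∑ x with CrossZero A B C x, ‖((overlapPreparation U V).val *ᵥ zeroKet _) x‖ ^ 2 =
      F ^ 2) :
    2 / 3 ≤ (fidelityEstimation τ D).outputProb U V {x | |x - F| < ε} := by
  have hs : ‖WithLp.toLp 2 ((overlapPreparation U V).val *ᵥ
      zeroKet ((A ⊕ B) ⊕ (A ⊕ C)))‖ = 1 := by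
    rw [← unitaryIsometry_apply, LinearIsometry.norm_map, zeroKet, PiLp.toLp_single,
      PiLp.norm_single, norm_one]
  have hq := congrArg (WithLp.toLp 2)
    (groverIterate_quadratic (overlapPreparation U V) (fun _ => false) (CrossZero A B C) h)
  simp only [WithLp.toLp_add, WithLp.toLp_smul, ← unitaryIsometry_apply _ (_ *ᵥ _)] at hq
  refine (two_thirds_le_sum_norm_sq_amplitudeEstimate hs hF hq hε hε1 hN).trans_eq ?_
  calc _ = ∑ j with |amplitudeEstimate N (τ j) - F| < ε,
        ∑ x, ‖slice (runGates U V (fidelityEstimationGates A B C τ D) (zeroKet _)) j x‖ ^ 2 := by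
        rw [Finset.sum_filter, Finset.sum_filter, ← Equiv.sum_comp τ]
        refine Finset.sum_congr rfl fun j _ => ?_
        rw [← slice_runGates_fidelityEstimationGates U V τ hD, EuclideanSpace.norm_sq_eq]
    _ = _ := by
        rw [← sum_norm_sq_slice _ fun j => |amplitudeEstimate N (τ j) - F| < ε]
        refine Finset.sum_congr rfl fun z _ => ?_
        symm
        split_ifs with hz
        · exact Set.indicator_of_mem
            (s := (fidelityEstimation (A := A) (B := B) (C := C) τ D).output ⁻¹' _) hz _
        · exact Set.indicator_of_notMem
            (s := (fidelityEstimation (A := A) (B := B) (C := C) τ D).output ⁻¹' _) hz _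

end Algorithm

/-! ### Choice of the window length -/

theorem exists_two_pow_between {x : ℝ} (hx : 1 ≤ x) : ∃ n : ℕ, x ≤ 2 ^ n ∧ (2 : ℝ) ^ n ≤ 2 * x := by
  obtain ⟨n, h1, h2⟩ := exists_nat_pow_near hx one_lt_two
  exact ⟨n + 1, h2.le, by rw [pow_succ]; linarith⟩

end

theorem theorem4p2 :
    ∃ C : ℝ, 0 < C ∧ ∀ (k a b : ℕ) (ε : ℝ), 0 < ε → ε < 1 →
      ∃ 𝒜 : QueryAlgorithm (Fin k ⊕ Fin a) (Fin k ⊕ Fin b),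
        (𝒜.queries : ℝ) ≤ C / ε ∧
        ∀ (U : QUnitary (Fin k ⊕ Fin a)) (V : QUnitary (Fin k ⊕ Fin b))
          (ρ : Matrix (Bits (Fin k)) (Bits (Fin k)) ℂ) (ψ : Bits (Fin k) → ℂ),
          IsMixedState ρ → IsPureState ψ → PreparesMixed U ρ → PreparesPure V ψ →
            fidelity ρ (ketBra ψ) = √(star ψ ⬝ᵥ (ρ *ᵥ ψ)).re ∧
            2 / 3 ≤ 𝒜.outputProb U V {x | |x - fidelity ρ (ketBra ψ)| < ε} := by
  -- There are `3 + 6N` queries, with `N ≤ 6/ε` by rounding `3/ε` up to a power of two, and `3 ≤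
  -- 3/ε`.
  refine ⟨39, by norm_num, fun k a b ε hε hε1 => ?_⟩
  have h1 : 1 ≤ 1 / ε := (one_le_div hε).2 hε1.le
  have h3 : 3 / ε = 3 * (1 / ε) := by ring
  obtain ⟨n, hn1, hn2⟩ := exists_two_pow_between (x := 3 / ε) (by linarith)
  have hN : 3 / ε ≤ ((2 ^ n : ℕ) : ℝ) := by exact_mod_cast hn1
  have hN2 : 2 ≤ 2 ^ n := by
    have : (2 : ℝ) ≤ ((2 ^ n : ℕ) : ℝ) := by linarith
    exact_mod_cast this
  -- Any bijection serves, since oracle-independent unitaries are free and arbitrary.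
  let τ : Bits (Fin n) ≃ ZMod (2 ^ n) := Fintype.equivOfCardEq (by simp [ZMod.card])
  obtain ⟨D, hD⟩ := exists_unitary_mulVec_single (fun _ => false)
    (φ := fun j : Bits (Fin n) => (parabolicWindow (2 ^ n) (τ j).val : ℂ)) (by
      simp only [Complex.norm_real, Real.norm_eq_abs, sq_abs]
      rw [Equiv.sum_comp τ fun m => parabolicWindow (2 ^ n) m.val ^ 2,
        sum_zmod_val fun t => parabolicWindow (2 ^ n) t ^ 2, sum_parabolicWindow_sq hN2])
  refine ⟨fidelityEstimation τ D, ?_, fun U V ρ ψ hρ hψ hU hV => ?_⟩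
  · rw [queries_fidelityEstimation]
    push_cast
    have h39 : 39 / ε = 39 * (1 / ε) := by ring
    linarith
  · have hfid := fidelity_ketBra hψ hρ.1
    refine ⟨hfid, ?_⟩
    rw [hfid]
    refine two_thirds_le_outputProb_fidelityEstimation U V τ hD hε hε1 hN (Real.sqrt_nonneg _) ?_
    rw [Real.sq_sqrt (Complex.nonneg_iff.1 (hρ.1.dotProduct_mulVec_nonneg ψ)).1]
    exact sum_norm_sq_overlapPreparation hψ hU hV
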